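/- Let $X$ be a first countable Hausdorff space such that every closed subset of $X$ is separable (in its subspace topology), and assume that $X$ admits a non-trivial convergent sequence, i.e., there are $\ell\in X$ and a sequence $(\ell_n)$ in $X$ converging to $\ell$ with $\ell_n\neq \ell$ for all $n$. Let $\mathcal{I}$ be an ideal on $\mathbf{N}$, i.e., a family of subsets of $\mathbf{N}$ closed under subsets and finite unions, containing all finite sets, and with $\mathbf{N}\notin\mathcal{I}$. Identify $\mathcal{P}(\mathbf{N})$ with the Cantor space $\{0,1\}^{\mathbf{N}}$ through characteristic functions. Suppose that $\mathcal{I}$ is an analytic subset of $\mathcal{P}(\mathbf{N})$ which is not an $F_\sigma$-set, and that $\mathcal{I}$ is a P-ideal, i.e., for every sequence $(A_n)$ in $\mathcal{I}$ there exists $A\in\mathcal{I}$ such that $A_n\setminus A$ is finite for all $n$. Then, for every non-empty $F_\sigma$-set $B\subseteq X$, there exists a sequence $x=(x_n)_{n\in\mathbf{N}}$ in $X$ such that $\Lambda_x(\mathcal{I})=B$, where $\Lambda_x(\mathcal{I})$ is the set of all $\ell\in X$ for which there is a subsequence $(x_{n_k})$ converging to $\ell$ with $\{n_k:k\in\mathbf{N}\}\notin\mathcal{I}$.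 -/

import Mathlib

open Filter Topology TopologicalSpace MeasureTheory

/-- A set is `F_σ` if it is a countable union of closed sets. -/
def IsFSigma {Y : Type*} [TopologicalSpace Y] (S : Set Y) : Prop :=
  ∃ F : ℕ → Set Y, (∀ k, IsClosed (F k)) ∧ S = ⋃ k, F k

namespace NatIdeal

/-- The set of characteristic functions of the members of a family `I` of sets of natural numbers.
It is a subset of the Cantor space `ℕ → Bool` (with its product topology). -/
def charFuns (I : Order.Ideal (Set ℕ)) : Set (ℕ → Bool) :=
  {f | {n | f n = true} ∈ I}

/-- The standing convention on ideals: all finite sets belong to the ideal and the ideal is not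
the whole power set. (A Mathlib ideal of the lattice `Set ℕ` is non-empty and closed under subsets
and finite unions.) -/
def Admissible (I : Order.Ideal (Set ℕ)) : Prop :=
  (∀ A : Set ℕ, A.Finite → A ∈ I) ∧ Set.univ ∉ I

/-- P-ideals: `σ`-directed modulo finite sets. -/
def IsPIdeal (I : Order.Ideal (Set ℕ)) : Prop :=
  ∀ A : ℕ → Set ℕ, (∀ n, A n ∈ I) → ∃ B ∈ I, ∀ n, (A n \ B).Finite

/-- The ideal is an analytic subset of the Cantor space. -/
def IsAnalytic (I : Order.Ideal (Set ℕ)) : Prop :=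
  AnalyticSet (charFuns I)

/-- The ideal is an `F_σ` subset of the Cantor space. -/
def IsFSigmaIdeal (I : Order.Ideal (Set ℕ)) : Prop :=
  IsFSigma (charFuns I)

/-- The set of `I`-limit points of a sequence `x`: the limits of those subsequences whose
index set does not belong to `I`. -/
def limitPoints {X : Type*} [TopologicalSpace X] (I : Order.Ideal (Set ℕ)) (x : ℕ → X) : Set X :=
  {l | ∃ n : ℕ → ℕ, StrictMono n ∧ Set.range n ∉ I ∧ Tendsto (fun k => x (n k)) atTop (𝓝 l)}

end NatIdeal

/-! By a form of Solecki's theorem (`exists_closedHereditary_seq`), an analytic P-ideal consists of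
the sets that have, for every n, a tail in `F n`; the `F n` are closed and hereditary, and the union
of two members of `F (n + 1)` lies in `F n`. If `I` is not F_σ, no `F n` is contained in `I`, so
there are positive sets that are arbitrarily small in this sense. Made disjoint, they yield a
partition of ℕ into positive pieces such that a set with all its traces in `I` is itself in `I`
(`exists_label`).

Write `B` as a union of non-empty closed sets `C k`. The k-th piece is split into infinitely many
uniformly positive parts (`exists_split`), on which the sequence takes the values of a dense
sequence of `C k`. A positive index set has a positive trace on some piece, so its limit lies in `C
k`. Conversely, a point of `C k` is a limit of dense points by first countability, and
`exists_subsequence` realises this limit along a positive set. -/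

open Set

namespace NatIdeal

/-! ### Closed hereditary families of sets. -/

/-- A family of sets of natural numbers that is closed under subsets and closed in the Cantor
space, the latter being expressed through finite initial segments. -/
structure IsClosedHereditary (F : Set (Set ℕ)) : Prop where
  mono : ∀ ⦃x y : Set ℕ⦄, x ⊆ y → y ∈ F → x ∈ F
  of_initial : ∀ ⦃x : Set ℕ⦄, (∀ n, x ∩ Iio n ∈ F) → x ∈ F

/-- Every member of the ideal has a tail in the family. -/
def Absorbs (I : Order.Ideal (Set ℕ)) (F : Set (Set ℕ)) : Prop :=
  ∀ x ∈ I, ∃ m, x \ Iio m ∈ F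

/-- A family that is cofinal in the ideal for inclusion modulo finite sets. -/
def AlmostCofinal (I : Order.Ideal (Set ℕ)) (J : Set (Set ℕ)) : Prop :=
  ∀ x ∈ I, ∃ y ∈ J, (x \ y).Finite

theorem empty_mem (I : Order.Ideal (Set ℕ)) : (∅ : Set ℕ) ∈ I := I.bot_mem

theorem union_mem {I : Order.Ideal (Set ℕ)} {x y : Set ℕ} (hx : x ∈ I) (hy : y ∈ I) :
    x ∪ y ∈ I := I.sup_mem hx hy

theorem mem_of_subset {I : Order.Ideal (Set ℕ)} {x y : Set ℕ} (h : x ⊆ y) (hy : y ∈ I) :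
    x ∈ I := I.lower h hy

theorem mem_of_diff_Iio_mem {I : Order.Ideal (Set ℕ)} (hI : Admissible I) {x : Set ℕ} {m : ℕ}
    (h : x \ Iio m ∈ I) : x ∈ I :=
  mem_of_subset (y := (x \ Iio m) ∪ Iio m) (fun n hn => by by_cases h : n < m <;> simp [hn, h])
    (union_mem h (hI.1 _ (finite_Iio m)))

theorem exists_diff_Iio_subset {x y : Set ℕ} (h : (x \ y).Finite) : ∃ m, x \ Iio m ⊆ y := by
  obtain ⟨m, hm⟩ := h.bddAbove
  refine ⟨m + 1, fun n hn => ?_⟩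
  by_contra hy
  have := hm ⟨hn.1, hy⟩
  exact hn.2 (Nat.lt_succ_of_le this)

theorem IsClosedHereditary.inter {F G : Set (Set ℕ)} (hF : IsClosedHereditary F)
    (hG : IsClosedHereditary G) : IsClosedHereditary (F ∩ G) where
  mono _ _ h hy := ⟨hF.mono h hy.1, hG.mono h hy.2⟩
  of_initial _ h := ⟨hF.of_initial fun n => (h n).1, hG.of_initial fun n => (h n).2⟩

theorem Absorbs.inter {I : Order.Ideal (Set ℕ)} {F G : Set (Set ℕ)} (hF : IsClosedHereditary F)
    (hG : IsClosedHereditary G) (hIF : Absorbs I F) (hIG : Absorbs I G) : Absorbs I (F ∩ G) := by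
  intro x hx
  obtain ⟨m, hm⟩ := hIF x hx
  obtain ⟨k, hk⟩ := hIG x hx
  refine ⟨max m k, hF.mono ?_ hm, hG.mono ?_ hk⟩ <;>
  · intro n hn
    simp only [Set.mem_sdiff, mem_Iio, not_lt, max_le_iff] at hn ⊢
    tauto

theorem IsClosedHereditary.exists_initial_notMem {F : Set (Set ℕ)} (hF : IsClosedHereditary F)
    {x : Set ℕ} (hx : x ∉ F) (a : ℕ) : ∃ n, a < n ∧ x ∩ Iio n ∉ F := by
  by_contra! h
  refine hx (hF.of_initial fun n => hF.mono ?_ (h (max (a + 1) n) (by simp)))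
  intro k hk
  exact ⟨hk.1, mem_Iio.2 (lt_of_lt_of_le hk.2 (le_max_right _ _))⟩

theorem IsClosedHereditary.isClosed_preimage {F : Set (Set ℕ)} (hF : IsClosedHereditary F)
    {Y : Type*} [TopologicalSpace Y] {G : Y → Set ℕ} (hG : ∀ n, IsClopen {y | n ∈ G y}) :
    IsClosed {y | G y ∈ F} := by
  rw [← isOpen_compl_iff, isOpen_iff_mem_nhds]
  intro y hy
  obtain ⟨n, -, hn⟩ := hF.exists_initial_notMem hy 0
  have : ∀ᶠ z in 𝓝 y, ∀ k ∈ Iio n, (k ∈ G y → k ∈ G z) := by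
    rw [eventually_all_finite (finite_Iio n)]
    intro k _
    by_cases hk : k ∈ G y
    · filter_upwards [(hG k).isOpen.mem_nhds hk] with z hz _ using hz
    · exact Eventually.of_forall fun z h => absurd h hk
  filter_upwards [this] with z hz hzF
  exact hn (hF.mono (fun k hk => hz k hk.2 hk.1) hzF)

/-! ### Cofinal parametrisation of an analytic P-ideal. -/

/-- If `x i` witnesses the failure of each `J i`, a pseudo-union of the `x i` in `I` is almost
covered by a member of some `J i`, and then so is `x i`. -/
theorem exists_almostCofinal_of_iUnion {I : Order.Ideal (Set ℕ)} (hP : IsPIdeal I) {ι : Type*}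
    [Countable ι] {J : ι → Set (Set ℕ)} (hJ : AlmostCofinal I (⋃ i, J i)) :
    ∃ i, AlmostCofinal I (J i) := by
  by_contra! h
  simp only [AlmostCofinal, not_forall, not_exists, not_and] at h
  choose x hx hxJ using h
  cases isEmpty_or_nonempty ι
  · obtain ⟨y, hy, -⟩ := hJ ∅ (empty_mem I)
    simp at hy
  obtain ⟨e, he⟩ := exists_surjective_nat ι
  obtain ⟨B, hB, hxB⟩ := hP (fun n => x (e n)) fun n => hx _
  obtain ⟨y, hy, hBy⟩ := hJ B hB
  obtain ⟨i, hi⟩ := mem_iUnion.1 hy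
  obtain ⟨n, rfl⟩ := he i
  refine hxJ _ y hi (((hxB n).union hBy).subset fun k hk => ?_)
  by_cases hkB : k ∈ B
  · exact Or.inr ⟨hkB, hk.2⟩
  · exact Or.inl ⟨hk.1, hkB⟩

/-- A continuous parametrisation of part of the ideal by a Polish space, all of whose non-empty
open pieces are cofinal. -/
structure IsCofinalParam (I : Order.Ideal (Set ℕ)) {P : Type*} [TopologicalSpace P]
    (f : P → Set ℕ) : Prop where
  clopen : ∀ n, IsClopen {a | n ∈ f a}
  mem : ∀ a, f a ∈ I
  cofinal : ∀ U : Set P, IsOpen U → U.Nonempty → AlmostCofinal I (f '' U)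

/-- From the Baire space that parametrises `I`, delete all basic open sets with non-cofinal image.
There are countably many, so the previous lemma keeps the remainder cofinal. -/
theorem exists_isCofinalParam {I : Order.Ideal (Set ℕ)} (hA : IsAnalytic I) (hP : IsPIdeal I) :
    ∃ (P : Set (ℕ → ℕ)) (f : P → Set ℕ), P.Nonempty ∧ IsClosed P ∧ IsCofinalParam I f := by
  have h0 : (fun _ => false) ∈ charFuns I := by
    simpa [charFuns] using empty_mem I
  rw [IsAnalytic, AnalyticSet] at hA
  rcases hA with hA | ⟨g, hg, hgr⟩
  · rw [hA] at h0
    exact h0.elim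
  set f : (ℕ → ℕ) → Set ℕ := fun a => {n | g a n = true} with hf
  have hfI : ∀ a, f a ∈ I := fun a => by
    have : g a ∈ charFuns I := hgr ▸ mem_range_self a
    exact this
  have hfs : ∀ x ∈ I, ∃ a, f a = x := by
    classical
    intro x hx
    have : (fun n => decide (n ∈ x)) ∈ charFuns I := by simpa [charFuns] using hx
    rw [← hgr] at this
    obtain ⟨a, ha⟩ := this
    exact ⟨a, by simp [hf, ha]⟩
  have hclopen : ∀ n, IsClopen {a | n ∈ f a} := fun n =>
    (isClopen_discrete {true}).preimage ((continuous_apply n).comp hg)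
  have hbasis := isBasis_countableBasis (ℕ → ℕ)
  set Z : Set (Set (ℕ → ℕ)) := {b ∈ countableBasis (ℕ → ℕ) | ¬ AlmostCofinal I (f '' b)} with hZ
  have hZc : Z.Countable := (countable_countableBasis _).mono (sep_subset _ _)
  have : Countable Z := hZc.to_subtype
  have key : ∀ V, AlmostCofinal I (f '' V) → AlmostCofinal I (f '' (V ∩ (⋃₀ Z)ᶜ)) := by
    intro V hV
    let J : Option Z → Set (Set ℕ) := fun o => o.elim (f '' (V ∩ (⋃₀ Z)ᶜ)) (fun b => f '' b)
    have hJ : AlmostCofinal I (⋃ i, J i) := by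
      intro x hx
      obtain ⟨_, ⟨a, ha, rfl⟩, hxa⟩ := hV x hx
      refine ⟨f a, ?_, hxa⟩
      by_cases haZ : a ∈ ⋃₀ Z
      · obtain ⟨b, hb, hab⟩ := haZ
        exact mem_iUnion.2 ⟨some ⟨b, hb⟩, a, hab, rfl⟩
      · exact mem_iUnion.2 ⟨none, a, ⟨ha, haZ⟩, rfl⟩
    obtain ⟨i, hi⟩ := exists_almostCofinal_of_iUnion hP hJ
    cases i with
    | none => exact hi
    | some b => exact absurd hi b.2.2
  refine ⟨(⋃₀ Z)ᶜ, fun a => f a, ?_, ?_, fun n => ?_, fun a => hfI a, fun U hU hUne => ?_⟩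
  · have : AlmostCofinal I (f '' univ) := fun x hx => by
      obtain ⟨a, rfl⟩ := hfs x hx
      exact ⟨f a, ⟨a, mem_univ _, rfl⟩, by simp⟩
    obtain ⟨_, ⟨a, ha, -⟩, -⟩ := key univ this ∅ (empty_mem I)
    exact ⟨a, ha.2⟩
  · exact (isOpen_sUnion fun b hb => hbasis.isOpen hb.1).isClosed_compl
  · exact (hclopen n).preimage continuous_subtype_val
  · obtain ⟨V, hV, rfl⟩ := isOpen_induced_iff.1 hU
    obtain ⟨a, ha⟩ := hUne
    obtain ⟨b, hb, hab, hbV⟩ := hbasis.exists_subset_of_mem_open ha hV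
    have hbc : AlmostCofinal I (f '' b) := by
      by_contra hn
      exact a.2 ⟨b, ⟨hb, hn⟩, hab⟩
    have hVc : AlmostCofinal I (f '' V) := fun x hx => by
      obtain ⟨y, hy, hxy⟩ := hbc x hx
      exact ⟨y, image_mono hbV hy, hxy⟩
    intro x hx
    obtain ⟨_, ⟨c, hc, rfl⟩, hxy⟩ := key V hVc x hx
    exact ⟨f c, ⟨⟨c, hc.2⟩, hc.1, rfl⟩, hxy⟩

/-! ### Hereditary closures and Solecki's theorem. -/

/-- The closure in the Cantor space of the family of all subsets of the sets `f a`, `a ∈ U`. -/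
def hereditaryClosure {P : Type*} (f : P → Set ℕ) (U : Set P) : Set (Set ℕ) :=
  {x | ∀ n, ∃ a ∈ U, x ∩ Iio n ⊆ f a}

theorem isClosedHereditary_hereditaryClosure {P : Type*} (f : P → Set ℕ) (U : Set P) :
    IsClosedHereditary (hereditaryClosure f U) where
  mono x y h hy n := by
    obtain ⟨a, ha, hya⟩ := hy n
    exact ⟨a, ha, (inter_subset_inter_left _ h).trans hya⟩
  of_initial x h n := by
    obtain ⟨a, ha, hxa⟩ := h n n
    exact ⟨a, ha, fun k hk => hxa ⟨hk, hk.2⟩⟩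

theorem hereditaryClosure_mono {P : Type*} {f : P → Set ℕ} {U V : Set P} (h : U ⊆ V) :
    hereditaryClosure f U ⊆ hereditaryClosure f V := fun _ hx n =>
  let ⟨a, ha, hxa⟩ := hx n
  ⟨a, h ha, hxa⟩

variable {I : Order.Ideal (Set ℕ)}

theorem IsCofinalParam.absorbs {P : Type*} [TopologicalSpace P] {f : P → Set ℕ}
    (hf : IsCofinalParam I f) {U : Set P} (hU : IsOpen U) (hne : U.Nonempty) :
    Absorbs I (hereditaryClosure f U) := by
  intro x hx
  obtain ⟨_, ⟨a, ha, rfl⟩, hxa⟩ := hf.cofinal U hU hne x hx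
  obtain ⟨m, hm⟩ := exists_diff_Iio_subset hxa
  exact ⟨m, fun n => ⟨a, ha, inter_subset_left.trans hm⟩⟩

/-- Baire category in `P × P`: for some `m`, the unions `f a ∪ f b` cut below `m` lie in `F` for all
(a, b) in an open box `U × V`. The closures over `U` and `V`, restricted to sets beyond `m`, then
give `E`. -/
theorem IsCofinalParam.exists_absorbs_union {P : Type*} [TopologicalSpace P] [Nonempty P]
    [BaireSpace (P × P)] {f : P → Set ℕ} (hf : IsCofinalParam I f)
    {F : Set (Set ℕ)} (hF : IsClosedHereditary F) (hIF : Absorbs I F) :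
    ∃ E, IsClosedHereditary E ∧ Absorbs I E ∧ ∀ x ∈ E, ∀ y ∈ E, x ∪ y ∈ F := by
  have hclosed : ∀ m, IsClosed {p : P × P | (f p.1 ∪ f p.2) \ Iio m ∈ F} := by
    intro m
    refine hF.isClosed_preimage fun n => ?_
    by_cases hn : n < m
    · simpa [hn] using isClopen_empty
    · have := ((hf.clopen n).preimage (continuous_fst (X := P) (Y := P))).union
        ((hf.clopen n).preimage (continuous_snd (X := P) (Y := P)))
      convert this using 1
      ext p
      simp [hn]
  obtain ⟨m, ⟨a, b⟩, hab⟩ := nonempty_interior_of_iUnion_of_closed hclosed <| by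
    refine eq_univ_of_forall fun p => ?_
    obtain ⟨m, hm⟩ := hIF _ (union_mem (hf.mem p.1) (hf.mem p.2))
    exact mem_iUnion.2 ⟨m, hm⟩
  obtain ⟨U, V, hU, haU, hV, hbV, hUV⟩ :=
    mem_nhds_prod_iff'.1 (mem_interior_iff_mem_nhds.1 hab)
  refine ⟨(hereditaryClosure f U ∩ hereditaryClosure f V) ∩ {x | x ∩ Iio m = ∅},
    ⟨fun x y h hy => ?_, fun x h => ?_⟩, fun x hx => ?_, fun x hx y hy => ?_⟩
  · exact ⟨((isClosedHereditary_hereditaryClosure f U).inter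
      (isClosedHereditary_hereditaryClosure f V)).mono h hy.1,
      subset_eq_empty (inter_subset_inter_left _ h) hy.2⟩
  · refine ⟨((isClosedHereditary_hereditaryClosure f U).inter
      (isClosedHereditary_hereditaryClosure f V)).of_initial fun n => (h n).1, ?_⟩
    have := (h m).2
    simpa [inter_assoc] using this
  · have hG := (isClosedHereditary_hereditaryClosure f U).inter
      (isClosedHereditary_hereditaryClosure f V)
    obtain ⟨k, hk⟩ := (hf.absorbs hU ⟨a, haU⟩).inter (isClosedHereditary_hereditaryClosure f U)
      (isClosedHereditary_hereditaryClosure f V) (hf.absorbs hV ⟨b, hbV⟩) x hx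
    refine ⟨max k m, hG.mono ?_ hk, ?_⟩
    · intro n hn
      simp only [Set.mem_sdiff, mem_Iio, not_lt, max_le_iff] at hn ⊢
      tauto
    · ext n
      simp only [mem_inter_iff, Set.mem_sdiff, mem_Iio, mem_empty_iff_false, iff_false]
      omega
  · refine hF.of_initial fun n => ?_
    obtain ⟨c, hc, hxc⟩ := hx.1.1 n
    obtain ⟨d, hd, hyd⟩ := hy.1.2 n
    have hcd : (f c ∪ f d) \ Iio m ∈ F := hUV (mk_mem_prod hc hd)
    refine hF.mono (fun k hk => (mem_sdiff k).2 ⟨?_, fun hkm => ?_⟩) hcd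
    · rcases hk.1 with h | h
      · exact Or.inl (hxc ⟨h, hk.2⟩)
      · exact Or.inr (hyd ⟨h, hk.2⟩)
    · rcases hk.1 with h | h
      · exact (hx.2.le ⟨h, hkm⟩ : k ∈ (∅ : Set ℕ))
      · exact (hy.2.le ⟨h, hkm⟩ : k ∈ (∅ : Set ℕ))

/-- A set absorbed by all the hereditary closures is almost covered by two of the sets `f a`: the
two points are built simultaneously, taking turns in covering consecutive intervals. -/
theorem IsCofinalParam.mem_of_forall_absorbed {P : Type*} [MetricSpace P] [CompleteSpace P]
    [Nonempty P] {f : P → Set ℕ} (hI : Admissible I) (hf : IsCofinalParam I f) {x : Set ℕ}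
    (hx : ∀ U : Set P, IsOpen U → U.Nonempty → ∃ m, x \ Iio m ∈ hereditaryClosure f U) :
    x ∈ I := by
  -- A state holds the ball to be shrunk next, the waiting ball and the current bound. A step
  -- shrinks the first ball to cover the next interval of `x`, then swaps the two.
  let State := {s : P × ℝ × P × ℝ × ℕ // 0 < s.2.1 ∧ 0 < s.2.2.2.1 ∧
    x \ Iio s.2.2.2.2 ∈ hereditaryClosure f (Metric.ball s.1 s.2.1)}
  have step : ∀ (k : ℕ) (s : State), ∃ t : State,
      t.1.1 = s.1.2.2.1 ∧ t.1.2.1 = s.1.2.2.2.1 ∧ s.1.2.2.2.2 < t.1.2.2.2.2 ∧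
      Metric.closedBall t.1.2.2.1 t.1.2.2.2.1 ⊆ Metric.ball s.1.1 s.1.2.1 ∧
      t.1.2.2.2.1 ≤ (1 / 2) ^ k ∧
      ∀ b ∈ Metric.ball t.1.2.2.1 t.1.2.2.2.1,
        x ∩ Ico s.1.2.2.2.2 t.1.2.2.2.2 ⊆ f b := by
    rintro k ⟨⟨a, r, b, ρ, m⟩, hr, hρ, hm⟩
    dsimp only at hr hρ hm
    obtain ⟨m', hm'⟩ := hx (Metric.ball b ρ) Metric.isOpen_ball ⟨b, Metric.mem_ball_self hρ⟩
    set M := max (m + 1) m' with hM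
    have hMm : m < M := lt_of_lt_of_le (Nat.lt_succ_self m) (le_max_left _ _)
    have hM' : x \ Iio M ∈ hereditaryClosure f (Metric.ball b ρ) :=
      (isClosedHereditary_hereditaryClosure f _).mono
        (sdiff_subset_sdiff_right (Iio_subset_Iio (le_max_right _ _))) hm'
    obtain ⟨c, hc, hxc⟩ := hm M
    have hopen : ∀ᶠ d in 𝓝 c, ∀ n ∈ Iio M, n ∈ f c → n ∈ f d := by
      rw [eventually_all_finite (finite_Iio M)]
      intro n _
      by_cases hn : n ∈ f c
      · filter_upwards [(hf.clopen n).isOpen.mem_nhds hn] with z hz _ using hz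
      · exact Eventually.of_forall fun z h => absurd h hn
    obtain ⟨ε, hε, hball⟩ := Metric.eventually_nhds_iff_ball.1
      (hopen.and (Metric.isOpen_ball.mem_nhds hc))
    have hpow : (0 : ℝ) < (1 / 2) ^ k := by positivity
    refine ⟨⟨⟨b, ρ, c, min (ε / 2) ((1 / 2) ^ k), M⟩, hρ, by positivity, hM'⟩, rfl, rfl, hMm,
      ?_, min_le_right _ _, ?_⟩
    · intro d hd
      refine (hball d (Metric.mem_ball.2 (lt_of_le_of_lt hd ?_))).2
      exact lt_of_le_of_lt (min_le_left _ _) (half_lt_self hε)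
    · intro d hd n hn
      have hd' : d ∈ Metric.ball c ε :=
        Metric.mem_ball.2 <| lt_of_lt_of_le hd ((min_le_left _ _).trans (half_le_self hε.le))
      exact (hball d hd').1 n hn.2.2
        (hxc ⟨⟨hn.1, fun h => absurd hn.2.1 (not_le.2 h)⟩, hn.2.2⟩)
  choose next h1 h2 h3 h4 h5 h6 using step
  obtain ⟨p⟩ := ‹Nonempty P›
  obtain ⟨m₀, hm₀⟩ := hx (Metric.ball p 1) Metric.isOpen_ball ⟨p, Metric.mem_ball_self one_pos⟩
  let S : ℕ → State := fun n => Nat.rec ⟨⟨p, 1, p, 1, m₀⟩, one_pos, one_pos, hm₀⟩ next n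
  have hS : ∀ n, S (n + 1) = next n (S n) := fun _ => rfl
  let c : ℕ → P := fun n => (S n).1.1
  let r : ℕ → ℝ := fun n => (S n).1.2.1
  let m : ℕ → ℕ := fun n => (S n).1.2.2.2.2
  have hr : ∀ n, 0 < r n := fun n => (S n).2.1
  have hm : StrictMono m := strictMono_nat_of_lt_succ fun n => h3 n (S n)
  have hc2 : ∀ n, c (n + 2) = (S (n + 1)).1.2.2.1 := fun n => h1 _ _
  have hr2 : ∀ n, r (n + 2) = (S (n + 1)).1.2.2.2.1 := fun n => h2 _ _
  have hsub : ∀ n, Metric.closedBall (c (n + 2)) (r (n + 2)) ⊆ Metric.ball (c n) (r n) := by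
    intro n
    rw [hc2, hr2]
    exact h4 n (S n)
  have hrle : ∀ n, r (n + 2) ≤ (1 / 2) ^ n := fun n => by
    rw [hr2]
    exact h5 n (S n)
  have hcov : ∀ n, ∀ b ∈ Metric.ball (c (n + 2)) (r (n + 2)),
      x ∩ Ico (m n) (m (n + 1)) ⊆ f b := fun n => by
    rw [hc2, hr2]
    exact h6 n (S n)
  -- Stages of equal parity form a nested sequence of balls shrinking to a point.
  have branch : ∀ i, ∃ a : P, ∀ j, a ∈ Metric.ball (c (2 * j + i)) (r (2 * j + i)) := by
    intro i
    have hanti : Antitone fun j => Metric.closedBall (c (2 * j + i)) (r (2 * j + i)) :=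
      antitone_nat_of_succ_le fun j => by
        have := (hsub (2 * j + i)).trans Metric.ball_subset_closedBall
        rwa [show 2 * j + i + 2 = 2 * (j + 1) + i by ring] at this
    have hmem : ∀ j k, j ≤ k → c (2 * k + i) ∈ Metric.closedBall (c (2 * j + i)) (r (2 * j + i)) :=
      fun j k hjk => hanti hjk (Metric.mem_closedBall_self (hr _).le)
    have hrlim : Tendsto (fun j => r (2 * j + i)) atTop (𝓝 0) := by
      rw [← tendsto_add_atTop_iff_nat 1]
      refine squeeze_zero (fun j => (hr _).le) (g := fun j => (1 / 2 : ℝ) ^ j) (fun j => ?_)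
        (tendsto_pow_atTop_nhds_zero_of_lt_one (by norm_num) (by norm_num))
      have := hrle (2 * j + i)
      rw [show 2 * (j + 1) + i = 2 * j + i + 2 by ring]
      exact this.trans (pow_le_pow_of_le_one (by norm_num) (by norm_num) (by omega))
    have hcauchy : CauchySeq fun j => c (2 * j + i) :=
      cauchySeq_of_le_tendsto_0' _ (fun j k hjk => by
        rw [dist_comm]
        exact hmem j k hjk) hrlim
    obtain ⟨a, ha⟩ := cauchySeq_tendsto_of_complete hcauchy
    refine ⟨a, fun j => ?_⟩
    have : a ∈ Metric.closedBall (c (2 * (j + 1) + i)) (r (2 * (j + 1) + i)) :=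
      Metric.isClosed_closedBall.mem_of_tendsto ha
        ((eventually_ge_atTop (j + 1)).mono fun k hk => hmem _ _ hk)
    rw [show 2 * (j + 1) + i = 2 * j + i + 2 by ring] at this
    exact hsub _ this
  obtain ⟨a, ha⟩ := branch 0
  obtain ⟨b, hb⟩ := branch 1
  refine mem_of_diff_Iio_mem hI (m := m 0)
    (mem_of_subset ?_ (union_mem (hf.mem a) (hf.mem b)))
  rintro n ⟨hnx, hn⟩
  have hn : m 0 ≤ n := not_lt.1 hn
  have hex : ∃ k, n < m (k + 1) := ⟨n, lt_of_lt_of_le (Nat.lt_succ_self n) (hm.id_le _)⟩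
  classical
  obtain ⟨k, hk, hmin⟩ : ∃ k, n < m (k + 1) ∧ m k ≤ n := by
    refine ⟨Nat.find hex, Nat.find_spec hex, ?_⟩
    rcases Nat.eq_zero_or_pos (Nat.find hex) with h | h
    · rw [h]; exact hn
    · have := Nat.find_min hex (Nat.sub_lt h one_pos)
      rwa [show Nat.find hex - 1 + 1 = Nat.find hex by omega, not_lt] at this
  rcases Nat.even_or_odd' k with ⟨j, rfl | rfl⟩
  · exact Or.inl (hcov _ a (ha (j + 1)) ⟨hnx, hmin, hk⟩)
  · refine Or.inr (hcov _ b ?_ ⟨hnx, hmin, hk⟩)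
    have := hb (j + 1)
    rwa [show 2 * (j + 1) + 1 = 2 * j + 1 + 2 by ring] at this

/-- A form of Solecki's theorem on analytic P-ideals. -/
theorem exists_closedHereditary_seq (hI : Admissible I) (hA : IsAnalytic I) (hP : IsPIdeal I) :
    ∃ F : ℕ → Set (Set ℕ), (∀ n, IsClosedHereditary (F n)) ∧
      (∀ n, ∀ x ∈ F (n + 1), ∀ y ∈ F (n + 1), x ∪ y ∈ F n) ∧
      ∀ x, x ∈ I ↔ ∀ n, ∃ m, x \ Iio m ∈ F n := by
  obtain ⟨P, f, hne, hclosed, hf⟩ := exists_isCofinalParam hA hP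
  have : Nonempty P := hne.to_subtype
  have : PolishSpace P := hclosed.polishSpace
  let := upgradeIsCompletelyMetrizable P
  have hbasis := isBasis_countableBasis P
  have : Countable (countableBasis P) := (countable_countableBasis P).to_subtype
  have : Nonempty (countableBasis P) := by
    obtain ⟨p⟩ := ‹Nonempty P›
    obtain ⟨b, hb, -, -⟩ := hbasis.exists_subset_of_mem_open (mem_univ p) isOpen_univ
    exact ⟨⟨b, hb⟩⟩
  obtain ⟨e, he⟩ := exists_surjective_nat (countableBasis P)
  let D : ℕ → Set (Set ℕ) := fun n => hereditaryClosure f (e n)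
  have hD : ∀ n, IsClosedHereditary (D n) := fun n => isClosedHereditary_hereditaryClosure f _
  have hDI : ∀ n, Absorbs I (D n) := fun n =>
    hf.absorbs (hbasis.isOpen (e n).2) (nonempty_of_mem_countableBasis (e n).2)
  let T := {F : Set (Set ℕ) // IsClosedHereditary F ∧ Absorbs I F}
  -- Cutting down by `D n` makes the final sequence handle every basic open set, as
  -- `mem_of_forall_absorbed` needs.
  have step : ∀ (n : ℕ) (F : T), ∃ E : T, (∀ x ∈ E.1, ∀ y ∈ E.1, x ∪ y ∈ F.1) ∧
      E.1 ⊆ D n := by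
    rintro n ⟨F, hF, hIF⟩
    obtain ⟨E, hE, hIE, hEF⟩ := hf.exists_absorbs_union hF hIF
    exact ⟨⟨E ∩ D n, hE.inter (hD n), hIE.inter hE (hD n) (hDI n)⟩,
      fun x hx y hy => hEF x hx.1 y hy.1, inter_subset_right⟩
  choose next h1 h2 using step
  let S : ℕ → T := fun n => Nat.rec ⟨D 0, hD 0, hDI 0⟩ next n
  refine ⟨fun n => (S n).1, fun n => (S n).2.1, fun n => h1 n (S n),
    fun x => ⟨fun hx n => (S n).2.2 x hx, fun hx => ?_⟩⟩
  refine hf.mem_of_forall_absorbed hI fun U hU ⟨p, hp⟩ => ?_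
  obtain ⟨b, hb, -, hbU⟩ := hbasis.exists_subset_of_mem_open hp hU
  obtain ⟨n, hn⟩ := he ⟨b, hb⟩
  obtain ⟨m, hm⟩ := hx (n + 1)
  refine ⟨m, hereditaryClosure_mono hbU ?_⟩
  have := h2 n (S n) hm
  simpa [D, hn] using this

/-! ### A partition into positive pieces that determines the ideal. -/

/-- Finite unions telescope; closedness then suffices, since an initial segment of the union is
covered by finitely many `A j`. -/
theorem iUnion_mem_of_mem {F : ℕ → Set (Set ℕ)} (hF : ∀ n, IsClosedHereditary (F n))
    (hU : ∀ n, ∀ x ∈ F (n + 1), ∀ y ∈ F (n + 1), x ∪ y ∈ F n) {q : ℕ} {A : ℕ → Set ℕ}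
    (hA : ∀ j, A j ∈ F (q + 1 + j)) : ⋃ j, A j ∈ F q := by
  have hfin : ∀ n (q : ℕ) (A : ℕ → Set ℕ), (∀ j, A j ∈ F (q + 1 + j)) →
      ⋃ j ∈ Iio n, A j ∈ F q := by
    intro n
    induction n with
    | zero =>
      intro q A hA
      have h := hU q _ (hA 0) _ (hA 0)
      exact (hF q).mono (by simp) h
    | succ n ih =>
      intro q A hA
      have h := hU q _ (hA 0) _ (ih (q + 1) (fun j => A (j + 1)) fun j => by
        rw [show q + 1 + 1 + j = q + 1 + (j + 1) by ring]
        exact hA (j + 1))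
      refine (hF q).mono (fun k hk => ?_) h
      simp only [mem_iUnion, mem_Iio, exists_prop, mem_union] at hk ⊢
      obtain ⟨j, hj, hkj⟩ := hk
      cases j with
      | zero => exact Or.inl hkj
      | succ j => exact Or.inr ⟨j, by omega, hkj⟩
  refine (hF q).of_initial fun n => ?_
  have : ∀ k, ∃ j, k ∈ ⋃ j, A j → k ∈ A j := fun k => by
    by_cases h : k ∈ ⋃ j, A j
    · obtain ⟨j, hj⟩ := mem_iUnion.1 h
      exact ⟨j, fun _ => hj⟩
    · exact ⟨0, fun h' => absurd h' h⟩
  choose w hw using this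
  obtain ⟨N, hN⟩ := ((finite_Iio n).image w).bddAbove
  refine (hF q).mono (fun k hk => ?_) (hfin (N + 1) q A hA)
  exact mem_biUnion (Nat.lt_succ_of_le (hN (mem_image_of_mem w hk.2))) (hw k hk.1)

/-- If `F n` were contained in `I`, then `I` would be the union over `m` of the closed families of
sets whose tail from `m` is in `F n`. -/
theorem exists_notMem_of_not_isFSigma {F : ℕ → Set (Set ℕ)} (hF : ∀ n, IsClosedHereditary (F n))
    (hFI : ∀ x, x ∈ I ↔ ∀ n, ∃ m, x \ Iio m ∈ F n) (hI : Admissible I)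
    (hnot : ¬ IsFSigmaIdeal I) (n : ℕ) : ∃ A ∈ F n, A ∉ I := by
  by_contra! h
  refine hnot ⟨fun m => {g | {k | g k = true} \ Iio m ∈ F n}, fun m => ?_, ?_⟩
  · refine (hF n).isClosed_preimage fun k => ?_
    by_cases hk : k < m
    · simpa [hk] using isClopen_empty
    · have := (isClopen_discrete ({true} : Set Bool)).preimage
        (continuous_apply (A := fun _ : ℕ => Bool) k)
      convert this using 1
      ext g
      simp [hk]
  · ext g
    simp only [mem_iUnion]
    exact ⟨fun hg => (hFI _).1 hg n, fun ⟨m, hm⟩ => mem_of_diff_Iio_mem hI (h _ hm)⟩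

/-- An analytic P-ideal that is not `F_σ` is determined by its restrictions to the pieces of some
partition into positive sets. -/
theorem exists_label {F : ℕ → Set (Set ℕ)} (hF : ∀ n, IsClosedHereditary (F n))
    (hU : ∀ n, ∀ x ∈ F (n + 1), ∀ y ∈ F (n + 1), x ∪ y ∈ F n)
    (hFI : ∀ x, x ∈ I ↔ ∀ n, ∃ m, x \ Iio m ∈ F n) (hpos : ∀ n, ∃ A ∈ F n, A ∉ I) :
    ∃ L : ℕ → ℕ, (∀ S : Set ℕ, (∀ k, S ∩ {n | L n = k} ∈ I) → S ∈ I) ∧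
      ∀ k, ∃ p, ∀ m, {n | L n = k} \ Iio m ∉ F p := by
  classical
  have hanti : Antitone F := antitone_nat_of_succ_le fun n x hx => by
    simpa using hU n x hx x hx
  have : ∀ n, ∃ (A : Set ℕ) (p : ℕ), A ∈ F n ∧ ∀ m, A \ Iio m ∉ F p := fun n => by
    obtain ⟨A, hA, hAI⟩ := hpos n
    rw [hFI] at hAI
    push Not at hAI
    obtain ⟨p, hp⟩ := hAI
    exact ⟨A, p, hA, hp⟩
  choose A p hA hp using this
  -- The growth of `q` puts the union `T k` of all later sets into `F (p (q k) + 1)`, so removing it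
  -- from `A (q k)` leaves a positive set.
  let q : ℕ → ℕ := fun k => Nat.rec 0 (fun _ b => max b (p b) + 2) k
  have hq : ∀ k, q (k + 1) = max (q k) (p (q k)) + 2 := fun _ => rfl
  have hqadd : ∀ k j, q k + j ≤ q (k + j) := by
    intro k j
    induction j with
    | zero => simp
    | succ j ih =>
      rw [← add_assoc, ← add_assoc, hq]
      have := le_max_left (q (k + j)) (p (q (k + j)))
      omega
  let T : ℕ → Set ℕ := fun k => ⋃ j, A (q (k + 1 + j))
  have hTmem : ∀ k b, b + 1 ≤ q (k + 1) → T k ∈ F b := fun k b hb =>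
    iUnion_mem_of_mem hF hU fun j => hanti (by have := hqadd (k + 1) j; omega) (hA _)
  have hTp : ∀ k, T k ∈ F (p (q k) + 1) := fun k => hTmem k _ (by
    rw [hq]
    have := le_max_right (q k) (p (q k))
    omega)
  have hTk : ∀ k, T k ∈ F k := fun k => hTmem k _ (by
    have := hqadd 0 (k + 1)
    rw [zero_add] at this
    omega)
  have hlast : ∀ n k l, n ∈ A (q k) \ T k → n ∈ A (q l) \ T l → k = l := by
    have : ∀ n k l, n ∈ A (q k) \ T k → n ∈ A (q l) \ T l → ¬ k < l := by
      intro n k l hk hl hkl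
      refine hk.2 (mem_iUnion.2 ⟨l - (k + 1), ?_⟩)
      rw [show k + 1 + (l - (k + 1)) = l by omega]
      exact hl.1
    intro n k l hk hl
    exact le_antisymm (not_lt.1 (this n l k hl hk)) (not_lt.1 (this n k l hk hl))
  -- The default label 0 makes `hL'` vacuous for the remaining points.
  let L : ℕ → ℕ := fun n => if h : ∃ k, n ∈ A (q k) \ T k then h.choose else 0
  have hL : ∀ n k, n ∈ A (q k) \ T k → L n = k := fun n k h => by
    have hex : ∃ k, n ∈ A (q k) \ T k := ⟨k, h⟩
    simp only [L, dif_pos hex]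
    exact hlast n _ _ hex.choose_spec h
  have hL' : ∀ n k, k < L n → n ∈ T k := fun n k h => by
    by_cases hex : ∃ k, n ∈ A (q k) \ T k
    · obtain ⟨l, hl⟩ := hex
      rw [hL n l hl] at h
      refine mem_iUnion.2 ⟨l - (k + 1), ?_⟩
      rw [show k + 1 + (l - (k + 1)) = l by omega]
      exact hl.1
    · simp only [L, dif_neg hex, not_lt_zero] at h
  refine ⟨L, fun S hS => (hFI S).2 fun n => ?_, fun k => ⟨p (q k) + 1, fun m hm => ?_⟩⟩
  · have hfin : ∀ k, S ∩ {i | L i < k} ∈ I := fun k => by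
      induction k with
      | zero => simpa using empty_mem I
      | succ k ih =>
        refine mem_of_subset (fun i hi => ?_) (union_mem ih (hS k))
        rcases Nat.lt_succ_iff_lt_or_eq.1 hi.2 with h | h
        · exact Or.inl ⟨hi.1, h⟩
        · exact Or.inr ⟨hi.1, h⟩
    obtain ⟨m, hm⟩ := (hFI _).1 (hfin (n + 2)) (n + 1)
    refine ⟨m, (hF n).mono (fun i hi => ?_) (hU n _ hm _ (hTk (n + 1)))⟩
    by_cases h : L i < n + 2
    · exact Or.inl ⟨⟨hi.1, h⟩, hi.2⟩
    · exact Or.inr (hL' i _ (by omega))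
  · refine hp (q k) m ((hF _).mono (fun i hi => ?_) (hU _ _ hm _ (hTp k)))
    by_cases h : i ∈ T k
    · exact Or.inr h
    · exact Or.inl ⟨hL i k ⟨hi.1, h⟩, hi.2⟩

/-! ### Block constructions inside a positive set. -/

/-- The index of the interval `[a i, a (i + 1))` to which a natural number belongs. -/
theorem exists_blockIndex {a : ℕ → ℕ} (ha : StrictMono a) :
    ∃ b : ℕ → ℕ, (∀ n i, a i ≤ n → n < a (i + 1) → b n = i) ∧ Tendsto b atTop atTop := by
  classical
  have hex : ∀ n, ∃ i, n < a (i + 1) := fun n =>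
    ⟨n, lt_of_lt_of_le (Nat.lt_succ_self n) (ha.id_le _)⟩
  have hb : ∀ n i, a i ≤ n → i ≤ Nat.find (hex n) := fun n i hi => by
    rw [Nat.le_find_iff]
    intro j hj
    exact not_lt.2 ((ha.monotone hj).trans hi)
  refine ⟨fun n => Nat.find (hex n), fun n i h1 h2 =>
    le_antisymm (Nat.find_min' _ h2) (hb n i h1), tendsto_atTop.2 fun i => ?_⟩
  exact (eventually_ge_atTop (a i)).mono fun n hn => hb n i hn

theorem exists_strictMono_blocks {Q : ℕ → ℕ → ℕ → Prop} (h : ∀ i a, ∃ b, a < b ∧ Q i a b) :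
    ∃ a : ℕ → ℕ, StrictMono a ∧ ∀ i, Q i (a i) (a (i + 1)) := by
  choose b hab hQ using h
  let a : ℕ → ℕ := fun n => Nat.rec 0 (fun i c => b i c) n
  exact ⟨a, strictMono_nat_of_lt_succ fun i => hab i (a i), fun i => hQ i (a i)⟩

theorem IsClosedHereditary.exists_block {F : Set (Set ℕ)} (hF : IsClosedHereditary F) {A : Set ℕ}
    (hA : ∀ m, A \ Iio m ∉ F) (a : ℕ) : ∃ b, a < b ∧ A ∩ Ico a b ∉ F := by
  obtain ⟨b, hb, h⟩ := hF.exists_initial_notMem (hA a) a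
  refine ⟨b, hb, fun h' => h (hF.mono (fun n hn => ?_) h')⟩
  exact ⟨hn.1.1, mem_Ico.2 ⟨not_lt.1 hn.1.2, hn.2⟩⟩

/-- A positive set splits into infinitely many uniformly positive pieces. -/
theorem IsClosedHereditary.exists_split {F : Set (Set ℕ)} (hF : IsClosedHereditary F) {A : Set ℕ}
    (hA : ∀ m, A \ Iio m ∉ F) : ∃ g : ℕ → ℕ, ∀ j m, (A ∩ {n | g n = j}) \ Iio m ∉ F := by
  obtain ⟨a, ha, hQ⟩ := exists_strictMono_blocks fun _ => hF.exists_block hA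
  obtain ⟨b, hb, -⟩ := exists_blockIndex ha
  -- Each `j` receives infinitely many blocks; block `Nat.pair j m` starts at or beyond `m`.
  refine ⟨fun n => (b n).unpair.1, fun j m h => hQ (Nat.pair j m) (hF.mono (fun n hn => ?_) h)⟩
  refine ⟨⟨hn.1, ?_⟩, notMem_Iio.2 ?_⟩
  · simp [hb n _ hn.2.1 hn.2.2]
  · exact ((Nat.right_le_pair j m).trans (ha.id_le _)).trans hn.2.1

/-- On the i-th block keep only the part labelled `w i`, with blocks long enough that this part is
outside `F p`. No tail of the resulting set lies in `F p`, and `t` is the block index. -/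
theorem exists_subsequence {F : ℕ → Set (Set ℕ)} (hI : Admissible I)
    (hF : ∀ n, IsClosedHereditary (F n)) (hFI : ∀ x, x ∈ I ↔ ∀ n, ∃ m, x \ Iio m ∈ F n)
    {p : ℕ} {A : Set ℕ} {g : ℕ → ℕ} (hg : ∀ j m, (A ∩ {n | g n = j}) \ Iio m ∉ F p)
    (w : ℕ → ℕ) : ∃ n t : ℕ → ℕ, StrictMono n ∧ range n ∉ I ∧ Tendsto t atTop atTop ∧
      ∀ i, n i ∈ A ∧ g (n i) = w (t i) := by
  classical
  obtain ⟨a, ha, hQ⟩ := exists_strictMono_blocks fun i => (hF p).exists_block (hg (w i))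
  obtain ⟨b, hb, hbt⟩ := exists_blockIndex ha
  set S : Set ℕ := {n | n ∈ A ∧ g n = w (b n)} with hS
  have hSI : S ∉ I := by
    rw [hFI]
    push Not
    refine ⟨p, fun m h => hQ m ((hF p).mono (fun n hn => ?_) h)⟩
    refine ⟨⟨hn.1.1, ?_⟩, notMem_Iio.2 ((ha.id_le m).trans hn.2.1)⟩
    rw [hb n m hn.2.1 hn.2.2]
    exact hn.1.2
  have hSinf : S.Infinite := fun h => hSI (hI.1 S h)
  have hn : StrictMono (Nat.nth (· ∈ S)) := Nat.nth_strictMono hSinf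
  refine ⟨Nat.nth (· ∈ S), fun i => b (Nat.nth (· ∈ S) i), hn, ?_,
    hbt.comp hn.tendsto_atTop, fun i => Nat.nth_mem_of_infinite hSinf i⟩
  exact (Nat.range_nth_of_infinite (p := (· ∈ S)) hSinf).symm ▸ hSI

end NatIdeal

/-! ### Construction of the sequence. -/

open NatIdeal in
theorem theorem2p5 {X : Type*} [TopologicalSpace X] [T2Space X] [FirstCountableTopology X]
    (hsep : ∀ C : Set X, IsClosed C → SeparableSpace C)
    (hconv : ∃ (u : ℕ → X) (l : X), (∀ n, u n ≠ l) ∧ Tendsto u atTop (𝓝 l))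
    (I : Order.Ideal (Set ℕ)) (hI : NatIdeal.Admissible I)
    (hanalytic : NatIdeal.IsAnalytic I) (hP : NatIdeal.IsPIdeal I)
    (hnot : ¬ NatIdeal.IsFSigmaIdeal I)
    (B : Set X) (hBne : B.Nonempty) (hB : IsFSigma B) :
    ∃ x : ℕ → X, NatIdeal.limitPoints I x = B := by
  classical
  obtain ⟨F, hF, hU, hFI⟩ := exists_closedHereditary_seq hI hanalytic hP
  obtain ⟨L, hL, hLpos⟩ := exists_label hF hU hFI (exists_notMem_of_not_isFSigma hF hFI hI hnot)
  choose p hp using hLpos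
  choose g hg using fun k => (hF (p k)).exists_split (hp k)
  obtain ⟨C, hC, hCne, rfl⟩ : ∃ C : ℕ → Set X, (∀ k, IsClosed (C k)) ∧ (∀ k, (C k).Nonempty) ∧
      B = ⋃ k, C k := by
    obtain ⟨C, hC, rfl⟩ := hB
    obtain ⟨b, hb⟩ := hBne
    obtain ⟨k₀, hk₀⟩ := mem_iUnion.1 hb
    refine ⟨fun k => if (C k).Nonempty then C k else C k₀, fun k => ?_, fun k => ?_, ?_⟩
    · dsimp only
      split_ifs
      exacts [hC k, hC k₀]
    · dsimp only
      split_ifs with h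
      exacts [h, ⟨b, hk₀⟩]
    · refine Subset.antisymm (iUnion_subset fun k y hy => mem_iUnion.2 ⟨k, ?_⟩)
        (iUnion_subset fun k => ?_)
      · rwa [if_pos ⟨y, hy⟩]
      · split_ifs
        exacts [subset_iUnion C k, subset_iUnion C k₀]
  have hdense : ∀ k, ∃ d : ℕ → X, (∀ j, d j ∈ C k) ∧ C k ⊆ closure (range d) := by
    intro k
    have := hsep (C k) (hC k)
    have := (hCne k).to_subtype
    refine ⟨fun j => denseSeq (C k) j, fun j => (denseSeq (C k) j).2, ?_⟩
    intro y hy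
    have h := image_closure_subset_closure_image continuous_subtype_val
      ⟨⟨y, hy⟩, denseRange_denseSeq (C k) _, rfl⟩
    rwa [← range_comp] at h
  choose d hdC hd using hdense
  refine ⟨fun n => d (L n) (g (L n) n), Subset.antisymm ?_ (iUnion_subset fun k l hl => ?_)⟩
  · rintro l ⟨n, hn, hnI, hlim⟩
    -- Otherwise all traces would be in `I`, hence the whole index set. A positive trace is
    -- infinite, so the subsequence visits the closed set `C k` infinitely often.
    have : ∃ k, range n ∩ {i | L i = k} ∉ I := by
      by_contra! h
      exact hnI (hL _ h)
    obtain ⟨k, hk⟩ := this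
    have hinf : (range n ∩ {i | L i = k}).Infinite := fun h => hk (hI.1 _ h)
    refine mem_iUnion.2 ⟨k, (hC k).mem_of_frequently_of_tendsto ?_ hlim⟩
    rw [Nat.frequently_atTop_iff_infinite]
    refine fun hfin => hinf ((hfin.image n).subset ?_)
    rintro _ ⟨⟨i, rfl⟩, hi⟩
    refine ⟨i, ?_, rfl⟩
    have hi : L (n i) = k := hi
    simp only [mem_ofPred_eq, hi, hdC]
  · obtain ⟨u, hu, hul⟩ := mem_closure_iff_seq_limit.1 (hd k hl)
    choose w hw using hu
    obtain ⟨n, t, hn, hnI, ht, hnt⟩ := exists_subsequence hI hF hFI (hg k) w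
    refine ⟨n, hn, hnI, (hul.comp ht).congr fun i => ?_⟩
    have h1 : L (n i) = k := (hnt i).1
    simp only [Function.comp_apply, h1, (hnt i).2, hw]
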